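/- (Matrix Hoeffding inequality for real square matrices.) Let $Q\ge 1$ and let $(\mathbf M_i)_{i\in I}$ be a finite family of independent random real $Q\times Q$ matrices (not necessarily symmetric), defined on a common probability space. Let $(a_i)_{i\in I}$ be fixed real numbers and assume that, for every $i\in I$, $\mathbb E\,\mathbf M_i=\mathbf 0$ and $\|\mathbf M_i\|\le a_i$ almost surely, where $\|\cdot\|$ is the spectral norm (the largest singular value, i.e. the operator norm with respect to the Euclidean norm on $\mathbb R^Q$). Put $\sigma^2=\sum_{i\in I}a_i^2$. If $\sigma^2>0$, then for all $\varepsilon\ge 0$, $$\mathbb P\Big\{\Big\|\sum_{i\in I}\mathbf M_i\Big\|\ge\varepsilon\Big\}\;\le\;2Q\,\exp\Big(\frac{-\varepsilon^2}{8\sigma^2}\Big).$$ If $\sigma^2=0$, then $\mathbb P\{\|\sum_{i\in I}\mathbf M_i\|\ge\varepsilon\}=0$ for all $\varepsilon>0$. -/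

import Mathlib

open MeasureTheory ProbabilityTheory
open scoped Matrix.Norms.L2Operator

/-- The product σ-algebra on real matrices (generated by the entries). -/
instance instMeasurableSpaceRealMatrix (m n : Type*) : MeasurableSpace (Matrix m n ℝ) :=
  inferInstanceAs (MeasurableSpace (m → n → ℝ))

/-- It is also the Borel σ-algebra. -/
instance instBorelSpaceRealMatrix (m n : Type*) [Countable m] [Countable n] :
    BorelSpace (Matrix m n ℝ) :=
  inferInstanceAs (BorelSpace (m → n → ℝ))

/-!
The proof is a Laplace-transform argument that uses neither the Golden–Thompson inequality nor
Lieb's concavity theorem. A square matrix `M` is replaced by its symmetric dilation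
`D M = [0, M; Mᵀ, 0]`, which depends linearly on `M` and has largest eigenvalue `‖M‖`; hence
`exp ‖M‖ ≤ G M` with `G M = tr (exp (D M))` (`Matrix.exp_norm_le_traceExpDilation`), and
`G 0 = 2 Q` for `Q × Q` matrices.

The core is a one-step estimate: if `Y` is centred and `‖Y‖ ≤ a` almost surely, then
`𝔼 G (A + Y) ≤ exp (2 a²) G A` for every fixed `A` (`Matrix.integral_traceExpDilation_add_le`).
For symmetric `A` and `X`, a trace `tr (f(A) g(X))` is a sum of `f(λᵢ) g(μⱼ)` with nonnegative
weights that do not depend on `f` and `g` (`Matrix.trace_conj_diagonal_mul_conj_diagonal`), so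
scalar inequalities in `λ` and `μ` pass to traces. The inequality
`e^μ - e^λ - (μ - λ) e^λ ≤ (μ - λ)² e^λ / 2 + (μ - λ)² e^μ` gives, after averaging,
`F ≤ F₀ + a² F₀ / 2 + a² F`, where `F = 𝔼 G (A + Y)` and `F₀ = G A`: the linear term vanishes by
centring, and `(D Y)² ≤ a²` as quadratic forms. For `a ≤ 1 / 2` this yields `F ≤ exp (2 a²) F₀`.
For `a ≥ 1 / 2` the crude bound `F ≤ exp a * F₀` is already enough. Since the constant `8` leaves
room, no sharper scalar inequality is necessary.

Independence iterates the estimate to `𝔼 G (∑ Mᵢ) ≤ 2 Q exp (2 ∑ aᵢ²)`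
(`Matrix.lintegral_traceExpDilation_sum_le`). Applied to `θ Mᵢ`, with Markov's inequality and
`θ = ε / (4 σ²)`, this is the tail bound.
-/

open Matrix

/-! ### Scalar inequalities -/

theorem Real.exp_le_one_add_add_sq_div_two_of_nonpos {x : ℝ} (hx : x ≤ 0) :
    Real.exp x ≤ 1 + x + x ^ 2 / 2 := by
  have h := Real.quadratic_le_exp_of_nonneg (neg_nonneg.mpr hx)
  have hmul : Real.exp x * Real.exp (-x) = 1 := by rw [← Real.exp_add]; simp
  have hpos : 0 < 1 + x + x ^ 2 / 2 := by nlinarith [sq_nonneg (1 + x)]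
  have : Real.exp x * (1 + -x + (-x) ^ 2 / 2) ≤ 1 :=
    (mul_le_mul_of_nonneg_left h (Real.exp_pos x).le).trans hmul.le
  have h' : 0 < 1 + -x + (-x) ^ 2 / 2 := by nlinarith
  refine le_of_mul_le_mul_right (this.trans ?_) h'
  nlinarith [sq_nonneg (x ^ 2)]

/-- The scalar inequality behind the one-step trace estimate. The coefficients `1 / 2` and `1` are
not optimal, but their sum is below `2`, which is what the constant `8` in the tail bound needs. -/
theorem Real.exp_sub_exp_sub_mul_le (x y : ℝ) :
    Real.exp y - Real.exp x - (y - x) * Real.exp x ≤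
      1 / 2 * ((y - x) ^ 2 * Real.exp x) + (y - x) ^ 2 * Real.exp y := by
  obtain ⟨d, rfl⟩ : ∃ d, y = x + d := ⟨y - x, by ring⟩
  have key : Real.exp d - 1 - d ≤ d ^ 2 / 2 + d ^ 2 * Real.exp d := by
    rcases le_total d 0 with hd | hd
    · have := Real.exp_le_one_add_add_sq_div_two_of_nonpos hd
      have := mul_nonneg (sq_nonneg d) (Real.exp_pos d).le
      linarith
    · have h1 : Real.exp d - 1 ≤ d * Real.exp d := by
        have := Real.add_one_le_exp (-d)
        have hmul : Real.exp d * Real.exp (-d) = 1 := by rw [← Real.exp_add]; simp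
        nlinarith [Real.exp_pos d]
      nlinarith [sq_nonneg d]
  rw [Real.exp_add]
  nlinarith [mul_le_mul_of_nonneg_left key (Real.exp_pos x).le]

theorem Real.one_add_half_le_exp_two_mul_mul {x : ℝ} (h0 : 0 ≤ x) (h1 : x ≤ 1 / 4) :
    1 + x / 2 ≤ Real.exp (2 * x) * (1 - x) := by
  have := Real.quadratic_le_exp_of_nonneg (show 0 ≤ 2 * x by linarith)
  have h2 : (1 + 2 * x + (2 * x) ^ 2 / 2) * (1 - x) ≤ Real.exp (2 * x) * (1 - x) := by
    gcongr; linarith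
  refine le_trans ?_ h2
  nlinarith [mul_nonneg h0 h0, mul_nonneg h0 (sub_nonneg.2 h1),
    mul_nonneg (mul_nonneg h0 h0) (sub_nonneg.2 h1)]

/-! ### Trace inequalities for exponentials of real symmetric matrices -/

section Symm

variable {n : Type*} [Fintype n] [DecidableEq n]

/-- The spectral theorem for a real symmetric matrix, written with plain matrices and together with
the resulting formula for the exponential. -/
theorem Matrix.IsSymm.exists_orthogonal_diagonal {A : Matrix n n ℝ} (hA : A.IsSymm) :
    ∃ (U : Matrix n n ℝ) (l : n → ℝ), Uᵀ * U = 1 ∧ U * Uᵀ = 1 ∧ A = U * diagonal l * Uᵀ ∧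
      NormedSpace.exp A = U * diagonal (fun i => Real.exp (l i)) * Uᵀ := by
  have hH : A.IsHermitian := by
    rw [Matrix.IsHermitian, conjTranspose_eq_transpose_of_trivial]; exact hA
  have hU := hH.eigenvectorUnitary.2
  rw [Matrix.mem_unitaryGroup_iff, star_eq_conjTranspose,
    conjTranspose_eq_transpose_of_trivial] at hU
  set U : Matrix n n ℝ := (hH.eigenvectorUnitary : Matrix n n ℝ) with hUdef
  have hU' : Uᵀ * U = 1 := mul_eq_one_comm.mp hU
  have hspec : A = U * diagonal hH.eigenvalues * Uᵀ := by
    have := hH.spectral_theorem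
    rwa [Unitary.conjStarAlgAut_apply, star_eq_conjTranspose,
      conjTranspose_eq_transpose_of_trivial] at this
  refine ⟨U, hH.eigenvalues, hU', hU, hspec, ?_⟩
  have hinv : U⁻¹ = Uᵀ := Matrix.inv_eq_left_inv hU'
  have hunit : IsUnit U := (Matrix.isUnit_iff_isUnit_det U).2 (isUnit_det_of_left_inverse hU')
  conv_lhs => rw [hspec, ← hinv, Matrix.exp_conj _ _ hunit, Matrix.exp_diagonal, hinv]
  congr 3
  ext i
  rw [Pi.coe_exp, Real.exp_eq_exp_ℝ]

/-- The trace of `f(A) g(X)` for symmetric `A` and `X` is a sum over pairs of eigenvalues whose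
weights, the squared inner products of the eigenvectors, depend on neither `f` nor `g` and are
nonnegative. An inequality between two-variable scalar functions thus passes to traces. -/
theorem Matrix.trace_conj_diagonal_mul_conj_diagonal (U V : Matrix n n ℝ) (f g : n → ℝ) :
    (U * diagonal f * Uᵀ * (V * diagonal g * Vᵀ)).trace =
      ∑ i, ∑ j, f i * g j * (Uᵀ * V) i j ^ 2 := by
  have : (U * diagonal f * Uᵀ * (V * diagonal g * Vᵀ)).trace =
      (diagonal f * (Uᵀ * V) * diagonal g * (Uᵀ * V)ᵀ).trace := by
    rw [transpose_mul, transpose_transpose]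
    rw [Matrix.trace_mul_comm (diagonal f * (Uᵀ * V) * diagonal g)]
    rw [show U * diagonal f * Uᵀ * (V * diagonal g * Vᵀ) =
      U * (diagonal f * Uᵀ * (V * diagonal g * Vᵀ)) by simp only [Matrix.mul_assoc]]
    rw [Matrix.trace_mul_comm U, Matrix.trace_mul_comm (Vᵀ * U)]
    simp only [Matrix.mul_assoc]
  rw [this]
  simp only [trace, diag_apply, Matrix.mul_apply (M := _ * diagonal g), mul_diagonal,
    diagonal_mul, transpose_apply]
  refine Finset.sum_congr rfl fun i _ => Finset.sum_congr rfl fun j _ => by ring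

theorem Matrix.trace_mul_exp_nonneg {H Z : Matrix n n ℝ} (hH : H.IsSymm)
    (hZ : ∀ v, 0 ≤ v ⬝ᵥ Z *ᵥ v) : 0 ≤ (Z * NormedSpace.exp H).trace := by
  obtain ⟨U, l, -, -, -, he⟩ := hH.exists_orthogonal_diagonal
  have : (Z * NormedSpace.exp H).trace =
      (Uᵀ * Z * U * diagonal (fun i => Real.exp (l i))).trace := by
    rw [he, ← Matrix.mul_assoc, Matrix.trace_mul_comm]
    simp only [Matrix.mul_assoc]
  rw [this]
  simp only [trace, diag_apply, mul_diagonal]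
  refine Finset.sum_nonneg fun i _ => mul_nonneg ?_ (Real.exp_pos _).le
  -- the `i`-th diagonal entry is the quadratic form of `Z` at the `i`-th eigenvector
  have := hZ (fun k => U k i)
  rwa [Matrix.mul_assoc, Matrix.mul_apply]

theorem Matrix.conj_diagonal_mul_conj_diagonal {W : Matrix n n ℝ} (hW : Wᵀ * W = 1)
    (f g : n → ℝ) :
    (W * diagonal f * Wᵀ) * (W * diagonal g * Wᵀ) = W * diagonal (fun i => f i * g i) * Wᵀ := by
  calc _ = W * diagonal f * (Wᵀ * W) * diagonal g * Wᵀ := by simp only [Matrix.mul_assoc]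
    _ = _ := by rw [hW, Matrix.mul_one, Matrix.mul_assoc W, diagonal_mul_diagonal]

theorem Matrix.conj_diagonal_one {W : Matrix n n ℝ} (hW : W * Wᵀ = 1) :
    W * diagonal (fun _ => (1 : ℝ)) * Wᵀ = 1 := by
  rw [diagonal_one, Matrix.mul_one, hW]

/-- A second-order Taylor bound for `tr exp` with a remainder controlled by both endpoints. The
first-order term is linear in `X - A`, so it vanishes on average when `X - A` is centred. -/
theorem Matrix.trace_exp_sub_trace_exp_sub_le {A X : Matrix n n ℝ} (hA : A.IsSymm)
    (hX : X.IsSymm) :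
    (NormedSpace.exp X).trace - (NormedSpace.exp A).trace - ((X - A) * NormedSpace.exp A).trace ≤
      1 / 2 * ((X - A) * (X - A) * NormedSpace.exp A).trace +
        ((X - A) * (X - A) * NormedSpace.exp X).trace := by
  obtain ⟨U, l, hU, hU', hAd, hAe⟩ := hA.exists_orthogonal_diagonal
  obtain ⟨V, m, hV, hV', hXd, hXe⟩ := hX.exists_orthogonal_diagonal
  obtain ⟨S, hS⟩ : ∃ S : (n → ℝ) → (n → ℝ) → ℝ, ∀ f g, S f g =
      ∑ i, ∑ j, f i * g j * (Uᵀ * V) i j ^ 2 := ⟨_, fun _ _ => rfl⟩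
  have T : ∀ f g, (U * diagonal f * Uᵀ * (V * diagonal g * Vᵀ)).trace = S f g := fun f g =>
    (trace_conj_diagonal_mul_conj_diagonal U V f g).trans (hS f g).symm
  have e1 : (NormedSpace.exp X).trace = S (fun _ => 1) (fun j => Real.exp (m j)) := by
    rw [← Matrix.one_mul (NormedSpace.exp X), ← conj_diagonal_one hU', hXe]; exact T _ _
  have e2 : (NormedSpace.exp A).trace = S (fun i => Real.exp (l i)) (fun _ => 1) := by
    rw [← Matrix.mul_one (NormedSpace.exp A), ← conj_diagonal_one hV', hAe]; exact T _ _
  have e3 : (X * NormedSpace.exp A).trace = S (fun i => Real.exp (l i)) m := by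
    rw [Matrix.trace_mul_comm, hAe, hXd]; exact T _ _
  have e4 : (A * NormedSpace.exp A).trace = S (fun i => l i * Real.exp (l i)) (fun _ => 1) := by
    conv_lhs => rw [hAe, hAd, conj_diagonal_mul_conj_diagonal hU,
      ← Matrix.mul_one (U * _ * _), ← conj_diagonal_one hV']
    exact T _ _
  have e5 : (X * X * NormedSpace.exp A).trace =
      S (fun i => Real.exp (l i)) (fun j => m j * m j) := by
    rw [Matrix.trace_mul_comm, hAe, hXd, conj_diagonal_mul_conj_diagonal hV]; exact T _ _
  have e6 : (X * A * NormedSpace.exp A).trace = S (fun i => l i * Real.exp (l i)) m := by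
    rw [Matrix.mul_assoc, Matrix.trace_mul_comm, hAe, hXd, hAd,
      conj_diagonal_mul_conj_diagonal hU]
    exact T _ _
  have e7 : (A * X * NormedSpace.exp A).trace = S (fun i => Real.exp (l i) * l i) m := by
    rw [Matrix.trace_mul_comm, ← Matrix.mul_assoc, hAe, hXd, hAd,
      conj_diagonal_mul_conj_diagonal hU]
    exact T _ _
  have e8 : (A * A * NormedSpace.exp A).trace =
      S (fun i => l i * l i * Real.exp (l i)) (fun _ => 1) := by
    conv_lhs => rw [hAe, hAd, conj_diagonal_mul_conj_diagonal hU,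
      conj_diagonal_mul_conj_diagonal hU, ← Matrix.mul_one (U * _ * _),
      ← conj_diagonal_one hV']
    exact T _ _
  have e9 : (X * X * NormedSpace.exp X).trace =
      S (fun _ => 1) (fun j => m j * m j * Real.exp (m j)) := by
    conv_lhs => rw [hXe, hXd, conj_diagonal_mul_conj_diagonal hV,
      conj_diagonal_mul_conj_diagonal hV, ← Matrix.one_mul (V * _ * _),
      ← conj_diagonal_one hU']
    exact T _ _
  have e10 : (X * A * NormedSpace.exp X).trace = S l (fun j => Real.exp (m j) * m j) := by
    rw [Matrix.trace_mul_comm, ← Matrix.mul_assoc, Matrix.trace_mul_comm, hXe, hXd, hAd,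
      conj_diagonal_mul_conj_diagonal hV]
    exact T _ _
  have e11 : (A * X * NormedSpace.exp X).trace = S l (fun j => m j * Real.exp (m j)) := by
    rw [Matrix.mul_assoc, hXe, hXd, hAd, conj_diagonal_mul_conj_diagonal hV]; exact T _ _
  have e12 : (A * A * NormedSpace.exp X).trace =
      S (fun i => l i * l i) (fun j => Real.exp (m j)) := by
    rw [hXe, hAd, conj_diagonal_mul_conj_diagonal hU]; exact T _ _
  simp only [Matrix.sub_mul, Matrix.mul_sub, trace_sub]
  rw [e1, e2, e3, e4, e5, e6, e7, e8, e9, e10, e11, e12]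
  simp only [hS, Finset.mul_sum, ← Finset.sum_sub_distrib, ← Finset.sum_add_distrib]
  refine Finset.sum_le_sum fun i _ => Finset.sum_le_sum fun j _ => ?_
  have := mul_le_mul_of_nonneg_right (Real.exp_sub_exp_sub_mul_le (l i) (m j))
    (sq_nonneg ((Uᵀ * V) i j))
  linarith

/-- Klein's inequality for `exp`, applied to `A + c • 1` and `X`, with
`tr (exp (A + c • 1)) = exp c * tr (exp A)` already substituted. -/
theorem Matrix.trace_exp_add_mul_sub_le {A X : Matrix n n ℝ} (hA : A.IsSymm)
    (hX : X.IsSymm) (c : ℝ) :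
    (NormedSpace.exp X).trace + c * (NormedSpace.exp X).trace -
      ((X - A) * NormedSpace.exp X).trace ≤ Real.exp c * (NormedSpace.exp A).trace := by
  obtain ⟨U, l, hU, hU', hAd, hAe⟩ := hA.exists_orthogonal_diagonal
  obtain ⟨V, m, hV, hV', hXd, hXe⟩ := hX.exists_orthogonal_diagonal
  obtain ⟨S, hS⟩ : ∃ S : (n → ℝ) → (n → ℝ) → ℝ, ∀ f g, S f g =
      ∑ i, ∑ j, f i * g j * (Uᵀ * V) i j ^ 2 := ⟨_, fun _ _ => rfl⟩
  have T : ∀ f g, (U * diagonal f * Uᵀ * (V * diagonal g * Vᵀ)).trace = S f g := fun f g =>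
    (trace_conj_diagonal_mul_conj_diagonal U V f g).trans (hS f g).symm
  have e1 : (NormedSpace.exp X).trace = S (fun _ => 1) (fun j => Real.exp (m j)) := by
    rw [← Matrix.one_mul (NormedSpace.exp X), ← conj_diagonal_one hU', hXe]; exact T _ _
  have e2 : (NormedSpace.exp A).trace = S (fun i => Real.exp (l i)) (fun _ => 1) := by
    rw [← Matrix.mul_one (NormedSpace.exp A), ← conj_diagonal_one hV', hAe]; exact T _ _
  have e3 : (X * NormedSpace.exp X).trace = S (fun _ => 1) (fun j => m j * Real.exp (m j)) := by
    conv_lhs => rw [hXe, hXd, conj_diagonal_mul_conj_diagonal hV, ← Matrix.one_mul (V * _ * _),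
      ← conj_diagonal_one hU']
    exact T _ _
  have e4 : (A * NormedSpace.exp X).trace = S l (fun j => Real.exp (m j)) := by
    rw [hXe, hAd]; exact T _ _
  simp only [Matrix.sub_mul, trace_sub]
  rw [e1, e2, e3, e4]
  simp only [hS, Finset.mul_sum, ← Finset.sum_sub_distrib, ← Finset.sum_add_distrib]
  refine Finset.sum_le_sum fun i _ => Finset.sum_le_sum fun j _ => ?_
  -- the tangent line inequality for `exp` at `m j`, evaluated at `l i + c`
  have h : Real.exp (m j) + (c + l i - m j) * Real.exp (m j) ≤ Real.exp c * Real.exp (l i) := by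
    have h1 := Real.add_one_le_exp (c + l i - m j)
    rw [← Real.exp_add, show c + l i = (c + l i - m j) + m j by ring, Real.exp_add]
    nlinarith [Real.exp_pos (m j)]
  have := mul_le_mul_of_nonneg_right h (sq_nonneg ((Uᵀ * V) i j))
  linarith

/-- The largest eigenvalue of a symmetric matrix `H` is at most `log (tr (exp H))`. -/
theorem Matrix.IsSymm.dotProduct_mulVec_le_log_trace_exp {H : Matrix n n ℝ} (hH : H.IsSymm)
    (v : n → ℝ) : v ⬝ᵥ H *ᵥ v ≤ Real.log (NormedSpace.exp H).trace * (v ⬝ᵥ v) := by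
  obtain ⟨U, l, hU, hU', hd, he⟩ := hH.exists_orthogonal_diagonal
  have htr : (NormedSpace.exp H).trace = ∑ i, Real.exp (l i) := by
    rw [he, Matrix.trace_mul_comm, ← Matrix.mul_assoc, hU, Matrix.one_mul, trace_diagonal]
  have h1 : v ⬝ᵥ H *ᵥ v = ∑ i, l i * (Uᵀ *ᵥ v) i ^ 2 := by
    rw [hd, ← Matrix.mulVec_mulVec, ← Matrix.mulVec_mulVec, Matrix.dotProduct_mulVec,
      ← Matrix.mulVec_transpose, dotProduct]
    refine Finset.sum_congr rfl fun i _ => ?_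
    rw [mulVec_diagonal]; ring
  have h2 : v ⬝ᵥ v = ∑ i, (Uᵀ *ᵥ v) i ^ 2 := by
    have : v ⬝ᵥ v = v ⬝ᵥ U *ᵥ Uᵀ *ᵥ v := by rw [Matrix.mulVec_mulVec, hU', Matrix.one_mulVec]
    rw [this, Matrix.dotProduct_mulVec, ← Matrix.mulVec_transpose, dotProduct]
    exact Finset.sum_congr rfl fun i _ => (sq _).symm
  rw [h1, h2, Finset.mul_sum]
  refine Finset.sum_le_sum fun i _ => mul_le_mul_of_nonneg_right ?_ (sq_nonneg _)
  rw [htr]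
  refine (Real.log_exp (l i)).symm.le.trans (Real.log_le_log (Real.exp_pos _) ?_)
  exact Finset.single_le_sum (f := fun i => Real.exp (l i)) (fun i _ => (Real.exp_pos _).le)
    (Finset.mem_univ i)

theorem Matrix.trace_exp_nonneg {H : Matrix n n ℝ} (hH : H.IsSymm) :
    0 ≤ (NormedSpace.exp H).trace := by
  have := Matrix.trace_mul_exp_nonneg (Z := 1) hH fun v => by
    rw [one_mulVec]; exact Finset.sum_nonneg fun i _ => mul_self_nonneg _
  rwa [Matrix.one_mul] at this

theorem Matrix.trace_exp_pos [Nonempty n] {H : Matrix n n ℝ} (hH : H.IsSymm) :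
    0 < (NormedSpace.exp H).trace := by
  obtain ⟨U, l, hU, -, -, he⟩ := hH.exists_orthogonal_diagonal
  rw [he, Matrix.trace_mul_comm, ← Matrix.mul_assoc, hU, Matrix.one_mul, trace_diagonal]
  exact Finset.sum_pos (fun i _ => Real.exp_pos _) Finset.univ_nonempty

end Symm

/-! ### The symmetric dilation -/

section Dilation

variable {m n : Type*}

/-- The symmetric dilation `[0, M; Mᵀ, 0]` of a rectangular real matrix `M`. It is linear in `M`,
and its largest eigenvalue is `‖M‖`. -/
def Matrix.dilation (M : Matrix m n ℝ) : Matrix (m ⊕ n) (m ⊕ n) ℝ := fromBlocks 0 M Mᵀ 0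

theorem Matrix.isSymm_dilation (M : Matrix m n ℝ) : M.dilation.IsSymm := by
  simp [dilation, IsSymm, fromBlocks_transpose]

theorem Matrix.dilation_add (M N : Matrix m n ℝ) :
    (M + N).dilation = M.dilation + N.dilation := by
  simp [dilation, fromBlocks_add]

theorem Matrix.dilation_smul (c : ℝ) (M : Matrix m n ℝ) :
    (c • M).dilation = c • M.dilation := by
  simp [dilation, fromBlocks_smul]

theorem Matrix.continuous_dilation :
    Continuous (dilation : Matrix m n ℝ → Matrix (m ⊕ n) (m ⊕ n) ℝ) :=
  Continuous.matrix_fromBlocks continuous_const continuous_id continuous_id.matrix_transpose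
    continuous_const

theorem Matrix.dilation_mulVec [Fintype m] [Fintype n] (M : Matrix m n ℝ) (x : m → ℝ)
    (y : n → ℝ) :
    M.dilation *ᵥ Sum.elim x y = Sum.elim (M *ᵥ y) (Mᵀ *ᵥ x) := by
  simp [dilation, fromBlocks_mulVec]

theorem Matrix.mulVec_dotProduct_mulVec_le [Fintype m] [Fintype n] [DecidableEq n]
    {M : Matrix m n ℝ} {a : ℝ} (hM : ‖M‖ ≤ a) (x : n → ℝ) :
    (M *ᵥ x) ⬝ᵥ (M *ᵥ x) ≤ a ^ 2 * (x ⬝ᵥ x) := by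
  have h := (M.l2_opNorm_mulVec (WithLp.toLp 2 x)).trans
    (mul_le_mul_of_nonneg_right hM (norm_nonneg _))
  have h2 := pow_le_pow_left₀ (norm_nonneg _) h 2
  rw [mul_pow, EuclideanSpace.real_norm_sq_eq, EuclideanSpace.real_norm_sq_eq] at h2
  simpa [dotProduct, sq] using h2

variable [Fintype m] [DecidableEq m] [Fintype n] [DecidableEq n]

/-- The trace of the exponential of the symmetric dilation, the Laplace-transform functional that
dominates `exp ‖M‖`. -/
noncomputable def Matrix.traceExpDilation (M : Matrix m n ℝ) : ℝ :=
  (NormedSpace.exp M.dilation).trace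

theorem Matrix.dilation_mulVec_dotProduct_le {M : Matrix m n ℝ} {a : ℝ} (hM : ‖M‖ ≤ a)
    (v : m ⊕ n → ℝ) : (M.dilation *ᵥ v) ⬝ᵥ (M.dilation *ᵥ v) ≤ a ^ 2 * (v ⬝ᵥ v) := by
  obtain ⟨x, y, rfl⟩ : ∃ x y, v = Sum.elim x y := ⟨_, _, (Sum.elim_comp_inl_inr v).symm⟩
  have hT : ‖Mᵀ‖ ≤ a := by
    rwa [← conjTranspose_eq_transpose_of_trivial, l2_opNorm_conjTranspose]
  rw [dilation_mulVec, sumElim_dotProduct_sumElim, sumElim_dotProduct_sumElim]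
  linarith [mulVec_dotProduct_mulVec_le hM y, mulVec_dotProduct_mulVec_le hT x]

theorem Matrix.traceExpDilation_nonneg (M : Matrix m n ℝ) : 0 ≤ M.traceExpDilation :=
  trace_exp_nonneg M.isSymm_dilation

theorem Matrix.continuous_traceExpDilation :
    Continuous (traceExpDilation : Matrix m n ℝ → ℝ) :=
  -- `NormedSpace.exp_continuous` is stated for normed `ℚ`-algebras
  letI : NormedAlgebra ℚ (Matrix (m ⊕ n) (m ⊕ n) ℝ) := NormedAlgebra.restrictScalars ℚ ℝ _
  (NormedSpace.exp_continuous.comp continuous_dilation).matrix_trace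

theorem Matrix.traceExpDilation_zero :
    (0 : Matrix m n ℝ).traceExpDilation = Fintype.card m + Fintype.card n := by
  have : (0 : Matrix m n ℝ).dilation = 0 := by simp [dilation]
  rw [traceExpDilation, this, NormedSpace.exp_zero, trace_one]
  simp

theorem Matrix.dotProduct_dilation_mulVec_le {M : Matrix m n ℝ} {a : ℝ} (hM : ‖M‖ ≤ a)
    (v : m ⊕ n → ℝ) : v ⬝ᵥ M.dilation *ᵥ v ≤ a * (v ⬝ᵥ v) := by
  have ha : 0 ≤ a := (norm_nonneg _).trans hM
  have h1 := dilation_mulVec_dotProduct_le hM v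
  have hsq : ∀ w : m ⊕ n → ℝ, 0 ≤ w ⬝ᵥ w := fun w =>
    Finset.sum_nonneg fun i _ => mul_self_nonneg _
  rcases ha.eq_or_lt with rfl | ha
  · have h0 : M.dilation *ᵥ v ⬝ᵥ M.dilation *ᵥ v = 0 := le_antisymm (by simpa using h1) (hsq _)
    rw [dotProduct_self_eq_zero.1 h0]; simp
  -- expand `0 ≤ ‖a v - D v‖²` for the dilation `D`
  · have h2 := hsq (a • v - M.dilation *ᵥ v)
    simp only [sub_dotProduct, dotProduct_sub, smul_dotProduct, dotProduct_smul, smul_eq_mul,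
      dotProduct_comm (M.dilation *ᵥ v) v] at h2
    refine le_of_mul_le_mul_left ?_ ha
    nlinarith

/-- The crude bound, which uses nothing but `‖M‖ ≤ a`; it suffices when `a` is not small. -/
theorem Matrix.traceExpDilation_add_le_exp_mul {M : Matrix m n ℝ} {a : ℝ} (hM : ‖M‖ ≤ a)
    (A : Matrix m n ℝ) :
    (A + M).traceExpDilation ≤ Real.exp a * A.traceExpDilation := by
  have h1 := trace_exp_add_mul_sub_le A.isSymm_dilation (A + M).isSymm_dilation a
  have h2 := trace_mul_exp_nonneg (H := (A + M).dilation) (Z := a • 1 - M.dilation)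
    (isSymm_dilation _) fun v => by
      have := dotProduct_dilation_mulVec_le hM v
      rw [sub_mulVec, smul_mulVec, one_mulVec, dotProduct_sub, dotProduct_smul, smul_eq_mul]
      linarith
  rw [Matrix.sub_mul, trace_sub, Matrix.smul_mul, Matrix.one_mul, trace_smul, smul_eq_mul] at h2
  rw [show (A + M).dilation - A.dilation = M.dilation by rw [dilation_add]; abel] at h1
  rw [traceExpDilation, traceExpDilation]
  linarith

theorem Matrix.trace_dilation_sq_mul_exp_le {M : Matrix m n ℝ} {a : ℝ} (hM : ‖M‖ ≤ a)
    (A : Matrix m n ℝ) :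
    (M.dilation * M.dilation * NormedSpace.exp A.dilation).trace ≤
      a ^ 2 * A.traceExpDilation := by
  have h2 := trace_mul_exp_nonneg (H := A.dilation)
    (Z := a ^ 2 • 1 - M.dilation * M.dilation) (isSymm_dilation _) fun v => by
      have := dilation_mulVec_dotProduct_le hM v
      rw [sub_mulVec, smul_mulVec, one_mulVec, dotProduct_sub, dotProduct_smul, smul_eq_mul,
        ← mulVec_mulVec, dotProduct_mulVec v, ← mulVec_transpose, M.isSymm_dilation.eq]
      linarith
  rw [Matrix.sub_mul, trace_sub, Matrix.smul_mul, Matrix.one_mul, trace_smul, smul_eq_mul] at h2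
  rw [traceExpDilation]
  linarith

/-- The bound used when `a` is small: the term linear in `M` averages to zero for a centred `M`. -/
theorem Matrix.traceExpDilation_add_le {M : Matrix m n ℝ} {a : ℝ} (hM : ‖M‖ ≤ a)
    (A : Matrix m n ℝ) :
    (A + M).traceExpDilation ≤ A.traceExpDilation +
      (M.dilation * NormedSpace.exp A.dilation).trace +
      1 / 2 * (a ^ 2 * A.traceExpDilation) + a ^ 2 * (A + M).traceExpDilation := by
  have h := trace_exp_sub_trace_exp_sub_le A.isSymm_dilation (A + M).isSymm_dilation
  rw [show (A + M).dilation - A.dilation = M.dilation by rw [dilation_add]; abel] at h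
  have h1 := trace_dilation_sq_mul_exp_le hM A
  have h2 := trace_dilation_sq_mul_exp_le hM (A + M)
  rw [← traceExpDilation, ← traceExpDilation] at h
  linarith

/-- The dilation has the eigenvalue `‖M‖` itself, so no factor is lost: the bound for `‖M‖` comes
from testing the quadratic form of the dilation at vectors `(M y, L y)`, where
`L = log M.traceExpDilation`. -/
theorem Matrix.exp_norm_le_traceExpDilation [Nonempty n] (M : Matrix m n ℝ) :
    Real.exp ‖M‖ ≤ M.traceExpDilation := by
  set L := Real.log M.traceExpDilation with hL
  have key : ∀ (x : m → ℝ) (y : n → ℝ), 2 * (x ⬝ᵥ M *ᵥ y) ≤ L * (x ⬝ᵥ x + y ⬝ᵥ y) := by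
    intro x y
    have := M.isSymm_dilation.dotProduct_mulVec_le_log_trace_exp (Sum.elim x y)
    rw [dilation_mulVec, sumElim_dotProduct_sumElim, sumElim_dotProduct_sumElim,
      mulVec_transpose, dotProduct_comm y, ← dotProduct_mulVec] at this
    rw [hL, traceExpDilation]
    linarith
  have hL0 : 0 ≤ L := by
    obtain ⟨j⟩ := ‹Nonempty n›
    simpa using key 0 (Pi.single j 1)
  have hpos : 0 < M.traceExpDilation := trace_exp_pos M.isSymm_dilation
  rw [← Real.le_log_iff_exp_le hpos, l2_opNorm_def]
  refine ContinuousLinearMap.opNorm_le_bound _ hL0 fun x => ?_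
  refine (sq_le_sq₀ (norm_nonneg _) (by positivity)).1 ?_
  rw [mul_pow, EuclideanSpace.real_norm_sq_eq, EuclideanSpace.real_norm_sq_eq]
  have h : (M *ᵥ x.ofLp) ⬝ᵥ (M *ᵥ x.ofLp) ≤ L ^ 2 * (x.ofLp ⬝ᵥ x.ofLp) := by
    rcases hL0.eq_or_lt with h0 | h0
    -- for `L = 0` the vector `(M y, 0)` would give nothing, but `(M y, y)` forces `M y = 0`
    · have := key (M *ᵥ x.ofLp) x.ofLp
      rw [← h0] at this ⊢
      linarith
    · have := key (M *ᵥ x.ofLp) (L • x.ofLp)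
      simp only [mulVec_smul, dotProduct_smul, smul_dotProduct, smul_eq_mul] at this
      refine le_of_mul_le_mul_left ?_ h0
      linarith
  simpa [dotProduct, sq] using h

end Dilation

/-! ### Exponential moments of random matrices -/

section Moments

variable {m n : Type*} [Fintype m] [DecidableEq m] [Fintype n] [DecidableEq n]

/-- Adding a centred random matrix of norm at most `a` to a fixed matrix multiplies the expected
`traceExpDilation` by at most `exp (2 * a ^ 2)`. -/
theorem Matrix.integral_traceExpDilation_add_le (P : Measure (Matrix m n ℝ))
    [IsProbabilityMeasure P] {a : ℝ} (hbound : ∀ᵐ x ∂P, ‖x‖ ≤ a) (hmean : ∫ x, x ∂P = 0)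
    (A : Matrix m n ℝ) :
    Integrable (fun x => (A + x).traceExpDilation) P ∧
    ∫ x, (A + x).traceExpDilation ∂P ≤ Real.exp (2 * a ^ 2) * A.traceExpDilation := by
  have ha : 0 ≤ a := by
    obtain ⟨x, hx⟩ := hbound.exists
    exact (norm_nonneg x).trans hx
  have hA := A.traceExpDilation_nonneg
  -- properness yields second countability, hence strong measurability of continuous maps
  have : ProperSpace (Matrix m n ℝ) := FiniteDimensional.proper_real _
  have hcont : Continuous fun x : Matrix m n ℝ => (A + x).traceExpDilation :=
    continuous_traceExpDilation.comp (continuous_const.add continuous_id)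
  have hle : ∀ᵐ x ∂P, (A + x).traceExpDilation ≤ Real.exp a * A.traceExpDilation := by
    filter_upwards [hbound] with x hx using traceExpDilation_add_le_exp_mul hx A
  have hint : Integrable (fun x => (A + x).traceExpDilation) P := by
    refine Integrable.of_bound hcont.aestronglyMeasurable
      (Real.exp a * A.traceExpDilation) ?_
    filter_upwards [hle] with x hx
    rwa [Real.norm_of_nonneg (traceExpDilation_nonneg _)]
  refine ⟨hint, ?_⟩
  rcases le_total (1 / 2) a with h | h
  -- if `1 / 2 ≤ a` then `exp a ≤ exp (2 * a ^ 2)`, and centring is not needed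
  · calc ∫ x, (A + x).traceExpDilation ∂P
        ≤ ∫ _, Real.exp a * A.traceExpDilation ∂P :=
          integral_mono_ae hint (integrable_const _) hle
      _ = Real.exp a * A.traceExpDilation := by simp
      _ ≤ _ := by
        gcongr
        nlinarith
  -- otherwise the mean `F` occurs on both sides of the second-order bound, with coefficient
  -- `a ^ 2 ≤ 1 / 4` on the right, and can be absorbed
  · let φ : Matrix m n ℝ →L[ℝ] ℝ := LinearMap.toContinuousLinearMap
      { toFun := fun x => (x.dilation * NormedSpace.exp A.dilation).trace
        map_add' := fun x y => by rw [dilation_add, Matrix.add_mul, trace_add]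
        map_smul' := fun c x => by
          rw [dilation_smul, Matrix.smul_mul, trace_smul, RingHom.id_apply] }
    have hid : Integrable (fun x : Matrix m n ℝ => x) P :=
      Integrable.of_bound continuous_id.aestronglyMeasurable a hbound
    have hφ : ∫ x, φ x ∂P = 0 := by
      rw [φ.integral_comp_comm hid, hmean, map_zero]
    have hφint : Integrable (fun x => φ x) P := φ.integrable_comp hid
    set F := ∫ x, (A + x).traceExpDilation ∂P with hF
    have hstep : F ≤ A.traceExpDilation + 0 + 1 / 2 * (a ^ 2 * A.traceExpDilation) +
        a ^ 2 * F := by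
      calc F ≤ ∫ x, (A.traceExpDilation + φ x + 1 / 2 * (a ^ 2 * A.traceExpDilation) +
            a ^ 2 * (A + x).traceExpDilation) ∂P := by
            refine integral_mono_ae hint
              ((((integrable_const _).add hφint).add (integrable_const _)).add
                (hint.const_mul _)) ?_
            filter_upwards [hbound] with x hx using traceExpDilation_add_le hx A
        _ = _ := by
          have h1 := (integrable_const (μ := P) A.traceExpDilation).add hφint
          have h2 := h1.add (integrable_const (1 / 2 * (a ^ 2 * A.traceExpDilation)))
          refine (integral_add h2 (hint.const_mul _)).trans ?_
          rw [integral_const_mul]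
          congr 1
          refine (integral_add h1 (integrable_const _)).trans ?_
          rw [integral_const, probReal_univ, one_smul]
          congr 1
          refine (integral_add (integrable_const _) hφint).trans ?_
          rw [integral_const, probReal_univ, one_smul, hφ]
    have hsmall : a ^ 2 ≤ 1 / 4 := by nlinarith
    have hexp := mul_le_mul_of_nonneg_right
      (Real.one_add_half_le_exp_two_mul_mul (sq_nonneg a) hsmall) hA
    refine le_of_mul_le_mul_right (a := 1 - a ^ 2) ?_ (by linarith)
    linarith

/-- Exponential moment bound for a sum of independent centred bounded random matrices.
In the form with `∫⁻`, integrability is part of the conclusion. -/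
theorem Matrix.lintegral_traceExpDilation_sum_le {Ω ι : Type*} [MeasurableSpace Ω]
    {μ : Measure Ω} [IsProbabilityMeasure μ] {M : ι → Ω → Matrix m n ℝ} {a : ι → ℝ}
    (hmeas : ∀ i, Measurable (M i)) (hindep : iIndepFun M μ)
    (hmean : ∀ i, ∫ ω, M i ω ∂μ = 0) (hbound : ∀ i, ∀ᵐ ω ∂μ, ‖M i ω‖ ≤ a i)
    (s : Finset ι) :
    ∫⁻ ω, ENNReal.ofReal (∑ i ∈ s, M i ω).traceExpDilation ∂μ ≤
      ENNReal.ofReal (Real.exp (2 * ∑ i ∈ s, a i ^ 2) * (Fintype.card m + Fintype.card n)) := by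
  classical
  have : ProperSpace (Matrix m n ℝ) := FiniteDimensional.proper_real _
  have hG : Measurable fun x : Matrix m n ℝ => ENNReal.ofReal x.traceExpDilation :=
    continuous_traceExpDilation.measurable.ennreal_ofReal
  induction s using Finset.induction_on with
  | empty => simp [traceExpDilation_zero]
  | insert j s hj ih =>
    have hS : Measurable fun ω => ∑ i ∈ s, M i ω := by fun_prop
    have hind : IndepFun (fun ω => ∑ i ∈ s, M i ω) (M j) μ := by
      have := hindep.indepFun_finsetSum_of_notMem hmeas hj
      rwa [show (fun ω => ∑ i ∈ s, M i ω) = ∑ i ∈ s, M i by ext1 ω; simp]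
    have hprod := (indepFun_iff_map_prod_eq_prod_map_map hS.aemeasurable
      (hmeas j).aemeasurable).1 hind
    have : IsProbabilityMeasure (μ.map (M j)) :=
      Measure.isProbabilityMeasure_map (hmeas j).aemeasurable
    have hstep : ∀ x : Matrix m n ℝ,
        ∫⁻ y, ENNReal.ofReal (x + y).traceExpDilation ∂(μ.map (M j)) ≤
          ENNReal.ofReal (Real.exp (2 * a j ^ 2)) * ENNReal.ofReal x.traceExpDilation := by
      intro x
      have hb : ∀ᵐ y ∂(μ.map (M j)), ‖y‖ ≤ a j :=
        (ae_map_iff (hmeas j).aemeasurable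
          (measurableSet_le measurable_norm measurable_const)).2 (hbound j)
      have hm : ∫ y, y ∂(μ.map (M j)) = 0 :=
        (integral_map (hmeas j).aemeasurable
          continuous_id.aestronglyMeasurable).trans (hmean j)
      obtain ⟨h1, h2⟩ := integral_traceExpDilation_add_le (μ.map (M j)) hb hm x
      rw [← ofReal_integral_eq_lintegral_ofReal h1
        (ae_of_all _ fun y => traceExpDilation_nonneg _), ← ENNReal.ofReal_mul (Real.exp_pos _).le]
      exact ENNReal.ofReal_le_ofReal h2
    have hG2 : Measurable fun p : Matrix m n ℝ × Matrix m n ℝ =>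
        ENNReal.ofReal (p.1 + p.2).traceExpDilation := hG.comp (measurable_fst.add measurable_snd)
    calc ∫⁻ ω, ENNReal.ofReal (∑ i ∈ insert j s, M i ω).traceExpDilation ∂μ
        = ∫⁻ ω, ENNReal.ofReal (∑ i ∈ s, M i ω + M j ω).traceExpDilation ∂μ := by
          simp only [Finset.sum_insert hj, add_comm]
      _ = ∫⁻ p, ENNReal.ofReal (p.1 + p.2).traceExpDilation
            ∂(μ.map fun ω => (∑ i ∈ s, M i ω, M j ω)) :=
          (lintegral_map hG2 (hS.prodMk (hmeas j))).symm
      _ = ∫⁻ x, ∫⁻ y, ENNReal.ofReal (x + y).traceExpDilation ∂(μ.map (M j))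
            ∂(μ.map fun ω => ∑ i ∈ s, M i ω) := by
          rw [hprod, lintegral_prod _ hG2.aemeasurable]
      _ ≤ ∫⁻ x, ENNReal.ofReal (Real.exp (2 * a j ^ 2)) * ENNReal.ofReal x.traceExpDilation
            ∂(μ.map fun ω => ∑ i ∈ s, M i ω) := lintegral_mono hstep
      _ = ENNReal.ofReal (Real.exp (2 * a j ^ 2)) *
            ∫⁻ ω, ENNReal.ofReal (∑ i ∈ s, M i ω).traceExpDilation ∂μ := by
          rw [lintegral_const_mul _ hG, lintegral_map hG hS]
      _ ≤ ENNReal.ofReal (Real.exp (2 * a j ^ 2)) * ENNReal.ofReal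
            (Real.exp (2 * ∑ i ∈ s, a i ^ 2) * (Fintype.card m + Fintype.card n)) := by gcongr
      _ = _ := by
          rw [← ENNReal.ofReal_mul (Real.exp_pos _).le, ← mul_assoc, ← Real.exp_add,
            Finset.sum_insert hj, ← mul_add]

end Moments

/-! ### The tail bound -/

/-- Matrix Hoeffding inequality for real square matrices that need not be symmetric. The norm is the
spectral norm (operator norm with respect to the Euclidean norm). The second part is the meaning of
the bound when `∑ i, a i ^ 2 = 0`, where the quotient in the exponent is not defined. -/
theorem mainTheorem3 {Ω : Type*} [MeasurableSpace Ω] (μ : Measure Ω) [IsProbabilityMeasure μ]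
    {ι : Type*} [Fintype ι] (Q : ℕ) (hQ : 1 ≤ Q)
    (M : ι → Ω → Matrix (Fin Q) (Fin Q) ℝ) (a : ι → ℝ)
    (hmeas : ∀ i, Measurable (M i))
    (hindep : iIndepFun M μ)
    (hmean : ∀ i, ∫ ω, M i ω ∂μ = 0)
    (hbound : ∀ i, ∀ᵐ ω ∂μ, ‖M i ω‖ ≤ a i) :
    (0 < ∑ i, a i ^ 2 →
      ∀ ε : ℝ, 0 ≤ ε →
        μ.real {ω | ε ≤ ‖∑ i, M i ω‖} ≤
          2 * (Q : ℝ) * Real.exp (-ε ^ 2 / (8 * ∑ i, a i ^ 2))) ∧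
    (∑ i, a i ^ 2 = 0 →
      ∀ ε : ℝ, 0 < ε → μ {ω | ε ≤ ‖∑ i, M i ω‖} = 0) := by
  constructor
  · intro hσ ε hε
    set v := ∑ i, a i ^ 2 with hv
    have : Nonempty (Fin Q) := ⟨⟨0, hQ⟩⟩
    have : ProperSpace (Matrix (Fin Q) (Fin Q) ℝ) := FiniteDimensional.proper_real _
    -- `θ` minimizes the exponent `2 * θ ^ 2 * v - θ * ε` of the Chernoff bound
    set θ : ℝ := ε / (4 * v) with hθdef
    have hθ : 0 ≤ θ := by positivity
    have hmgf := lintegral_traceExpDilation_sum_le (M := fun i ω => θ • M i ω)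
      (a := fun i => θ * a i) (μ := μ) (fun i => (hmeas i).const_smul θ)
      (hindep.comp (fun _ x => θ • x) fun _ => measurable_const_smul θ)
      (fun i => by rw [integral_smul, hmean, smul_zero])
      (fun i => by
        filter_upwards [hbound i] with ω hω
        rw [norm_smul, Real.norm_of_nonneg hθ]
        gcongr) Finset.univ
    have hmarkov := mul_meas_ge_le_lintegral (μ := μ)
      (f := fun ω => ENNReal.ofReal (∑ i, θ • M i ω).traceExpDilation)
      ((continuous_traceExpDilation.measurable.comp
        (Finset.measurable_sum _ fun i _ => (hmeas i).const_smul θ)).ennreal_ofReal)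
      (ENNReal.ofReal (Real.exp (θ * ε)))
    have hsub : {ω | ε ≤ ‖∑ i, M i ω‖} ⊆ {ω | ENNReal.ofReal (Real.exp (θ * ε)) ≤
        ENNReal.ofReal (∑ i, θ • M i ω).traceExpDilation} := by
      intro ω hω
      refine ENNReal.ofReal_le_ofReal (le_trans ?_ (exp_norm_le_traceExpDilation _))
      rw [← Finset.smul_sum, norm_smul, Real.norm_of_nonneg hθ]
      exact Real.exp_le_exp.2 (mul_le_mul_of_nonneg_left hω hθ)
    have h := ((mul_le_mul_right (measure_mono hsub) _).trans hmarkov).trans hmgf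
    rw [← ofReal_measureReal, ← ENNReal.ofReal_mul (Real.exp_pos _).le,
      ENNReal.ofReal_le_ofReal_iff (by positivity)] at h
    refine le_of_mul_le_mul_left (h.trans_eq ?_) (Real.exp_pos (θ * ε))
    have hexp : 2 * ∑ i, (θ * a i) ^ 2 = θ * ε + -ε ^ 2 / (8 * v) := by
      simp only [mul_pow, ← Finset.mul_sum]
      rw [← hv, hθdef]
      field_simp
      ring
    rw [hexp, Real.exp_add, Fintype.card_fin]
    ring
  · intro hσ ε hε
    have ha : ∀ i, a i = 0 := fun i => by
      have := (Finset.sum_eq_zero_iff_of_nonneg fun i _ => sq_nonneg (a i)).1 hσ i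
        (Finset.mem_univ i)
      exact pow_eq_zero_iff two_ne_zero |>.1 this
    rw [measure_eq_zero_iff_ae_notMem]
    filter_upwards [ae_all_iff.2 hbound] with ω hω
    have h0 : ∑ i, M i ω = 0 := Finset.sum_eq_zero fun i _ => by
      have := hω i
      rwa [ha i, norm_le_zero_iff] at this
    simp [h0, hε]
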